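/- Let $\mathcal V$ be a variety of algebras, i.e. the category of models in $\mathbf{Set}$ of a small Lawvere theory $L$ (a category with finite products in which every object is isomorphic to a finite power of one distinguished object). For a category $\mathcal D$ with finite products, a $\mathcal V$-object in $\mathcal D$ is a finite-product-preserving functor $L\to\mathcal D$, and $\mathcal D\mathcal V$ is the category of these functors and natural transformations. For $A\in\mathcal D\mathcal V$ and $X\in\mathcal D$, $\mathrm{Hom}_{\mathcal D}(X,A)$ is a $\mathcal V$-algebra. A co-$\mathcal V$-algebra in $\mathcal V$ is a $\mathcal V$-object in $\mathcal V^{op}$; their category $\mathcal V\mathcal V^c$ is the opposite of the category of $\mathcal V$-objects in $\mathcal V^{op}$. For $C\in\mathcal V\mathcal V^c$ and $B\in\mathcal V$, $\mathrm{Hom}_{\mathcal V}(C,B)$ is a $\mathcal V$-algebra. For $C\in\mathcal V\mathcal V^c$ and $A\in\mathcal D\mathcal V$, $C\odot A$ denotes the $\mathcal V$-object in $\mathcal D$, unique up to unique isomorphism if it exists, with isomorphisms of $\mathcal V$-algebras $$\mathrm{Hom}_{\mathcal D}(X,C\odot A)\cong\mathrm{Hom}_{\mathcal V}(C,\mathrm{Hom}_{\mathcal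 D}(X,A))\quad\text{natural in }X .$$ **Theorem.** Let $\mathcal D$ be a locally small category that has finite products, has all small colimits, and is an $(E,M)$ category for a class $E$ of epimorphisms and a class $M$ of monomorphisms (both closed under composition with isomorphisms, every morphism is a morphism of $E$ followed by one of $M$, and every commutative square from a morphism of $E$ to one of $M$ has a diagonal). Suppose that $E$ is closed under finite products, that each object of $\mathcal D$ has up to isomorphism only a small set of quotients in $E$, and that finite products commute with small filtered colimits in $\mathcal D$. (1) If $\mathcal D$ also has all small limits, then $C\odot A$ exists for all $C$ and $A$, as a functor $(\mathcal V\mathcal V^c)^{op}\times\mathcal D\mathcal V\to\mathcal D\mathcal V$. (2) There is a functor $$\mathcal V\mathcal V^c\times\mathcal D\mathcal V\to\mathcal D\mathcal V,\qquad (C,A)\mapsto C\circledast A,$$ covariant in both arguments, with bijections, natural in $C$, $A$ and $A'$, $$\mathrm{Hom}_{\mathcal D\mathcal V}(C\circledast A,A')\cong\mathrm{Hom}(A,C\odot A').$$ Here the right-hand side is the set of natural transformations from $\mathrm{Hom}_{\mathcal D}(-,A)$ to $\mathrm{Hom}_{\mathcal V}(C,\mathrm{Hom}_{\mathcal D}(-,A'))$,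 as functors $\mathcal D^{op}\to\mathcal V$. The functor $\circledast$ is determined by this property up to isomorphism. Whenever $\odot$ exists as a functor $(\mathcal V\mathcal V^c)^{op}\times\mathcal D\mathcal V\to\mathcal D\mathcal V$ (in particular if $\mathcal D$ is complete), these bijections are natural bijections $$\mathrm{Hom}_{\mathcal D\mathcal V}(C\circledast A,A')\cong\mathrm{Hom}_{\mathcal D\mathcal V}(A,C\odot A').$$ (3) Suppose that $\odot$ exists as such a functor. Let $T$ be a Tall–Wraith $\mathcal V$-monoid, i.e. a monoid $(T,\mu\colon T\odot T\to T,\eta\colon I\to T)$ in $\mathcal V\mathcal V^c$ with the monoidal structure in which $C_1\odot C_2$ represents the functor $B\mapsto\mathrm{Hom}_{\mathcal V}(C_1,\mathrm{Hom}_{\mathcal V}(C_2,B))$ and $I$ represents the identity functor of $\mathcal V$. Let $A\in\mathcal D\mathcal V$. Then the canonical morphisms $(T\odot T)\circledast A\to T\circledast(T\circledast A)$ and $I\circledast A\to A$, adjoint to the canonical isomorphisms $(T\odot T)\odot B\cong T\odot(T\odot B)$ and $I\odot B\cong B$, are isomorphisms. A morphism $\rho\colon A\to T\odot A$ is a co-action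 of $T$ (coassociative and counital for the morphisms $T\odot A\to(T\odot T)\odot A\cong T\odot(T\odot A)$ and $T\odot A\to I\odot A\cong A$ induced by $\mu$ and $\eta$) if and only if the morphism $T\circledast A\to A$ that corresponds to $\rho$ under the bijection of (2) is an action of $T$ (associative and unital with respect to the above isomorphisms). -/

import Mathlib

open CategoryTheory Limits Opposite

universe w u

namespace VarietyOfAlgebras

/-- A category with finite products is a Lawvere theory if every object is isomorphic to a finite
power of a certain distinguished object. -/
def IsLawvereTheory (L : Type w) [SmallCategory L] [HasFiniteProducts L] : Prop :=
  ∃ x : L, ∀ y : L, ∃ n : ℕ, Nonempty (y ≅ ∏ᶜ fun _ : Fin n => x)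

/-- The category `DV` of `V`-objects in `D`: the models of the Lawvere theory `L` in `D`, that is,
the functors `L ⥤ D` that preserve finite products, with all natural transformations. -/
abbrev Models (L : Type w) [SmallCategory L] (D : Type u) [Category.{w} D] : Type (max u w) :=
  ObjectProperty.FullSubcategory (fun F : L ⥤ D => PreservesFiniteProducts F)

/-- The variety of algebras `V` of the Lawvere theory `L`. -/
abbrev Variety (L : Type w) [SmallCategory L] : Type (w + 1) := Models L (Type w)

/-- The category of co-`V`-objects in `D`: the opposite of the category of `V`-objects in `Dᵒᵖ`. -/
abbrev CoModels (L : Type w) [SmallCategory L] (D : Type u) [Category.{w} D] : Type (max u w) :=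
  (Models L Dᵒᵖ)ᵒᵖ

/-- The category of co-`V`-algebras in `V`. -/
abbrev CoAlg (L : Type w) [SmallCategory L] : Type (w + 1) := CoModels L (Variety L)

section

variable {L : Type w} [SmallCategory L] {D : Type u} [Category.{w} D]

/-- `Hom_D(X, A)` as a `V`-algebra, for an object `X` of `D` and a `V`-object `A` in `D`. -/
def homAlgObj (A : Models L D) (X : Dᵒᵖ) : Variety L :=
  ⟨A.obj ⋙ coyoneda.obj X, by
    have := A.property
    infer_instance⟩

/-- The functor `DV ⥤ (Dᵒᵖ ⥤ V)` that sends `A` to the `V`-algebra valued functor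
`Hom_D(-, A)`. -/
def homAlg : Models L D ⥤ (Dᵒᵖ ⥤ Variety L) where
  obj A :=
    { obj := fun X => homAlgObj A X
      map := fun f => ObjectProperty.homMk (Functor.whiskerLeft A.obj (coyoneda.map f)) }
  map f :=
    { app := fun X => ObjectProperty.homMk (Functor.whiskerRight f.hom (coyoneda.obj X))
      naturality := fun X Y g => by
        ext l x
        exact Category.assoc (obj := D) g.unop x (f.hom.app l) }

/-- `Hom_D(C, X)` as a `V`-algebra, for a co-`V`-object `C` in `D` and an object `X` of `D`. -/
def coHomAlgObj (C : (CoModels L D)ᵒᵖ) (X : D) : Variety L :=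
  ⟨C.unop.unop.obj ⋙ yoneda.obj X, by
    have := C.unop.unop.property
    infer_instance⟩

/-- The functor that sends a co-`V`-object `C` in `D` to the covariant functor
`Hom_D(C, -) : D ⥤ V` represented by it. -/
def cov : (CoModels L D)ᵒᵖ ⥤ (D ⥤ Variety L) where
  obj C :=
    { obj := fun X => coHomAlgObj C X
      map := fun f => ObjectProperty.homMk (Functor.whiskerLeft C.unop.unop.obj (yoneda.map f)) }
  map f :=
    { app := fun X =>
        ObjectProperty.homMk (Functor.whiskerRight f.unop.unop.hom (yoneda.obj X))
      naturality := fun X Y g => by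
        ext l x
        exact (Category.assoc (obj := D) (f.unop.unop.hom.app l).unop x g).symm }

/-- By naturality, a morphism `Hom_D(-, A) ⟶ Hom_D(-, B)` is determined by its values at the
identities. -/
theorem homAlg_yoneda {A B : Models L D} (θ : homAlg.obj A ⟶ homAlg.obj B) (X : D) (l : L)
    (g : X ⟶ A.obj.obj l) :
    (ConcreteCategory.hom ((θ.app (op X)).hom.app l) g : X ⟶ B.obj.obj l) =
      g ≫ (ConcreteCategory.hom ((θ.app (op (A.obj.obj l))).hom.app l) (𝟙 (A.obj.obj l)) :
        A.obj.obj l ⟶ B.obj.obj l) := by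
  have h := ConcreteCategory.congr_hom (NatTrans.congr_app
    (congrArg InducedCategory.Hom.hom (θ.naturality g.op)) l) (𝟙 (A.obj.obj l))
  have h' : (ConcreteCategory.hom ((θ.app (op X)).hom.app l) (g ≫ 𝟙 _) : X ⟶ B.obj.obj l) =
      g ≫ (ConcreteCategory.hom ((θ.app (op (A.obj.obj l))).hom.app l) (𝟙 (A.obj.obj l)) :
        A.obj.obj l ⟶ B.obj.obj l) := h
  rwa [Category.comp_id] at h'

/-- The functor `DV ⥤ (Dᵒᵖ ⥤ V)` is fully faithful: a `V`-object in `D` is determined by the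
lift of its contravariant hom-functor to `V`. -/
def homAlgFullyFaithful : (homAlg : Models L D ⥤ (Dᵒᵖ ⥤ Variety L)).FullyFaithful where
  preimage {A B} θ := ObjectProperty.homMk
    { app := fun l =>
        (ConcreteCategory.hom ((θ.app (op (A.obj.obj l))).hom.app l) (𝟙 (A.obj.obj l)) :
          A.obj.obj l ⟶ B.obj.obj l)
      naturality := fun l m f => by
        rw [← homAlg_yoneda θ _ m (A.obj.map f)]
        have h := ConcreteCategory.congr_hom
          ((θ.app (op (A.obj.obj l))).hom.naturality f) (𝟙 (A.obj.obj l))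
        have h' : (ConcreteCategory.hom ((θ.app (op (A.obj.obj l))).hom.app m)
            (𝟙 _ ≫ A.obj.map f) : A.obj.obj l ⟶ B.obj.obj m) =
            (ConcreteCategory.hom ((θ.app (op (A.obj.obj l))).hom.app l) (𝟙 (A.obj.obj l)) :
              A.obj.obj l ⟶ B.obj.obj l) ≫ B.obj.map f := h
        rwa [Category.id_comp] at h' }
  map_preimage {A B} θ := by
    ext X l g
    exact (homAlg_yoneda θ X.unop l g).symm
  preimage_map {A B} f := by
    ext l
    exact Category.id_comp (obj := D) (f.hom.app l)

variable (L D) in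
/-- A pairing `⊙ : (co-V-algebras)ᵒᵖ × DV ⥤ DV`. The `V`-object `C ⊙ A` in `D` is the one for
which there are isomorphisms of `V`-algebras `Hom_D(X, C ⊙ A) ≅ Hom_V(C, Hom_D(X, A))`, natural in
`X`, `C` and `A`. By the Yoneda lemma the pairing is unique up to a unique isomorphism. -/
structure CovPairing where
  /-- The bifunctor `(C, A) ↦ C ⊙ A`. -/
  functor : (CoAlg L)ᵒᵖ ⥤ Models L D ⥤ Models L D
  /-- The isomorphism `Hom_D(X, C ⊙ A) ≅ Hom_V(C, Hom_D(X, A))` of `V`-algebras. -/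
  iso (C : CoAlg L) (A : Models L D) :
    homAlg.obj ((functor.obj (op C)).obj A) ≅ homAlg.obj A ⋙ cov.obj (op C)
  iso_naturality_left {C C' : CoAlg L} (f : C ⟶ C') (A : Models L D) :
    homAlg.map ((functor.map f.op).app A) ≫ (iso C A).hom =
      (iso C' A).hom ≫ Functor.whiskerLeft (homAlg.obj A) (cov.map f.op)
  iso_naturality_right (C : CoAlg L) {A A' : Models L D} (f : A ⟶ A') :
    homAlg.map ((functor.obj (op C)).map f) ≫ (iso C A').hom =
      (iso C A).hom ≫ Functor.whiskerRight (homAlg.map f) (cov.obj (op C))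

/-- Natural bijections `Hom(C ⊛ A, A') ≅ Hom(A, C ⊙ A')` for a bifunctor `⊛`, where the `V`-objects
`A` and `C ⊙ A'` in `D` enter through the functors `Dᵒᵖ ⥤ V` that they represent, namely
`Hom_D(-, A)` and `Hom_V(C, Hom_D(-, A'))`. Thus the right-hand side makes sense whether or not the
second functor is representable, and it is the set of morphisms `A ⟶ C ⊙ A'` in `DV` if it is. -/
structure HomAdjunction (circ : CoAlg L ⥤ Models L D ⥤ Models L D) where
  /-- The bijection. -/
  homEquiv (C : CoAlg L) (A A' : Models L D) :
    ((circ.obj C).obj A ⟶ A') ≃ (homAlg.obj A ⟶ homAlg.obj A' ⋙ cov.obj (op C))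
  naturality_one {C C' : CoAlg L} (f : C ⟶ C') {A A' : Models L D}
    (g : (circ.obj C').obj A ⟶ A') :
    homEquiv C A A' ((circ.map f).app A ≫ g) =
      homEquiv C' A A' g ≫ Functor.whiskerLeft (homAlg.obj A') (cov.map f.op)
  naturality_two (C : CoAlg L) {A B A' : Models L D} (f : A ⟶ B)
    (g : (circ.obj C).obj B ⟶ A') :
    homEquiv C A A' ((circ.obj C).map f ≫ g) = homAlg.map f ≫ homEquiv C B A' g
  naturality_three (C : CoAlg L) {A A' B' : Models L D} (g : (circ.obj C).obj A ⟶ A')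
    (f : A' ⟶ B') :
    homEquiv C A B' (g ≫ f) =
      homEquiv C A A' g ≫ Functor.whiskerRight (homAlg.map f) (cov.obj (op C))

end

/-- A Tall-Wraith `V`-monoid: a monoid `(T, μ : T ⊙ T ⟶ T, η : I ⟶ T)` in the category of
co-`V`-algebras in `V`, with its monoidal structure in which `C₁ ⊙ C₂` represents the composite of
the functors represented by `C₂` and then `C₁`, and `I` represents the identity functor of `V`.
The objects `T ⊙ T` and `I`, which are unique up to a unique isomorphism, are part of the data.
Representing functors is fully faithful and contravariant, so the monoid axioms are stated
for the induced transformations `T(B) ⟶ T(T(B))` and `T(B) ⟶ B`. -/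
structure TallWraithMonoid (L : Type w) [SmallCategory L] where
  /-- The underlying object `T`. -/
  obj : CoAlg L
  /-- The object `T ⊙ T`. -/
  sq : CoAlg L
  /-- The monoidal unit `I`. -/
  unit : CoAlg L
  /-- `T ⊙ T` represents the composite of `Hom_V(T, -)` with itself. -/
  sqIso : cov.obj (op sq) ≅ cov.obj (op obj) ⋙ cov.obj (op obj)
  /-- `I` represents the identity functor. -/
  unitIso : cov.obj (op unit) ≅ 𝟭 (Variety L)
  /-- The multiplication. -/
  mul : sq ⟶ obj
  /-- The unit. -/
  one : unit ⟶ obj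
  mul_assoc (B : Variety L) :
    ((cov.map mul.op ≫ sqIso.hom).app B) ≫
        (cov.obj (op obj)).map ((cov.map mul.op ≫ sqIso.hom).app B) =
      ((cov.map mul.op ≫ sqIso.hom).app B) ≫
        (cov.map mul.op ≫ sqIso.hom).app ((cov.obj (op obj)).obj B)
  mul_one (B : Variety L) :
    ((cov.map mul.op ≫ sqIso.hom).app B) ≫
        (cov.obj (op obj)).map ((cov.map one.op ≫ unitIso.hom).app B) =
      𝟙 ((cov.obj (op obj)).obj B)
  one_mul (B : Variety L) :
    ((cov.map mul.op ≫ sqIso.hom).app B) ≫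
        (cov.map one.op ≫ unitIso.hom).app ((cov.obj (op obj)).obj B) =
      𝟙 ((cov.obj (op obj)).obj B)

section

variable {L : Type w} [SmallCategory L] {D : Type u} [Category.{w} D]

namespace CovPairing

variable (P : CovPairing L D) (T : TallWraithMonoid L)

/-- The canonical isomorphism `(T ⊙ T) ⊙ A ≅ T ⊙ (T ⊙ A)`. -/
def assocIso (A : Models L D) :
    (P.functor.obj (op T.sq)).obj A ≅
      (P.functor.obj (op T.obj)).obj ((P.functor.obj (op T.obj)).obj A) :=
  homAlgFullyFaithful.preimageIso
    (P.iso T.sq A ≪≫ Functor.isoWhiskerLeft (homAlg.obj A) T.sqIso ≪≫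
      (Functor.associator _ _ _).symm ≪≫
      Functor.isoWhiskerRight (P.iso T.obj A).symm (cov.obj (op T.obj)) ≪≫
      (P.iso T.obj ((P.functor.obj (op T.obj)).obj A)).symm)

/-- The canonical isomorphism `I ⊙ A ≅ A`. -/
def unitIso (A : Models L D) : (P.functor.obj (op T.unit)).obj A ≅ A :=
  homAlgFullyFaithful.preimageIso
    (P.iso T.unit A ≪≫ Functor.isoWhiskerLeft (homAlg.obj A) T.unitIso ≪≫
      Functor.rightUnitor _)

/-- The condition that `ρ : A ⟶ T ⊙ A` is a co-action of `T` on `A`: it is compatible with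
`T ⊙ A ⟶ (T ⊙ T) ⊙ A ≅ T ⊙ (T ⊙ A)` and with `T ⊙ A ⟶ I ⊙ A ≅ A`, which are induced by the
multiplication and the unit of `T`. -/
structure IsCoaction {A : Models L D} (ρ : A ⟶ (P.functor.obj (op T.obj)).obj A) : Prop where
  coassoc : ρ ≫ (P.functor.map T.mul.op).app A ≫ (P.assocIso T A).hom =
    ρ ≫ (P.functor.obj (op T.obj)).map ρ
  counit : ρ ≫ (P.functor.map T.one.op).app A ≫ (P.unitIso T A).hom = 𝟙 A

variable {P} {circ : CoAlg L ⥤ Models L D ⥤ Models L D} (adj : circ ⊣₂ P.functor)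

/-- The canonical morphism `(T ⊙ T) ⊛ A ⟶ T ⊛ (T ⊛ A)`: it is adjoint to the composite of
`A ⟶ T ⊙ (T ⊛ A) ⟶ T ⊙ (T ⊙ (T ⊛ (T ⊛ A)))`, formed from units of the adjunction, with the inverse
of the isomorphism `(T ⊙ T) ⊙ B ≅ T ⊙ (T ⊙ B)` for `B = T ⊛ (T ⊛ A)`. -/
def circAssoc (A : Models L D) :
    (circ.obj T.sq).obj A ⟶ (circ.obj T.obj).obj ((circ.obj T.obj).obj A) :=
  adj.homEquiv.symm
    (adj.homEquiv (𝟙 ((circ.obj T.obj).obj A)) ≫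
      (P.functor.obj (op T.obj)).map
        (adj.homEquiv (𝟙 ((circ.obj T.obj).obj ((circ.obj T.obj).obj A)))) ≫
      (P.assocIso T ((circ.obj T.obj).obj ((circ.obj T.obj).obj A))).inv)

/-- The canonical morphism `I ⊛ A ⟶ A`: it is adjoint to the inverse of `I ⊙ A ≅ A`. -/
def circUnit (A : Models L D) : (circ.obj T.unit).obj A ⟶ A :=
  adj.homEquiv.symm (P.unitIso T A).inv

/-- The condition that `a : T ⊛ A ⟶ A` is an action of `T` on `A` for the pairing `⊛`: the
composites `(T ⊙ T) ⊛ A ⟶ T ⊛ (T ⊛ A) ⟶ T ⊛ A ⟶ A` and `(T ⊙ T) ⊛ A ⟶ T ⊛ A ⟶ A` agree, and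
`I ⊛ A ⟶ T ⊛ A ⟶ A` is the canonical morphism. -/
structure IsAction {A : Models L D} (a : (circ.obj T.obj).obj A ⟶ A) : Prop where
  assoc : circAssoc T adj A ≫ (circ.obj T.obj).map a ≫ a = (circ.map T.mul).app A ≫ a
  unit : (circ.map T.one).app A ≫ a = circUnit T adj A

end CovPairing

/-- `D` is an `(E, M)` category: `E` is a class of epimorphisms and `M` a class of monomorphisms,
both closed under composition with isomorphisms, every morphism factors as a morphism in `E`
followed by one in `M`, and every commutative square from `E` to `M` has a diagonal (which is
unique, because `E` consists of epimorphisms). -/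
structure IsFactorizationCategory (E M : MorphismProperty D) : Prop where
  epi : E ≤ MorphismProperty.epimorphisms D
  mono : M ≤ MorphismProperty.monomorphisms D
  respectsIso_left : E.RespectsIso
  respectsIso_right : M.RespectsIso
  factorization : E.HasFactorization M
  diagonal {X Y Z W : D} (e : X ⟶ Y) (m : Z ⟶ W) : E e → M m → HasLiftingProperty e m

/-- `D` is `E`-co-well-powered: up to isomorphism, each object `X` has only a small set of
quotients `X ⟶ Y` in `E`. -/
def IsCoWellPowered (E : MorphismProperty D) : Prop :=
  ∀ X : D, ObjectProperty.EssentiallySmall.{w} (fun Y : Under X => E Y.hom)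

variable (D) in
/-- Finite products commute with filtered colimits in `D`: forming small filtered colimits
preserves finite products of diagrams. -/
def FiniteProductsCommuteWithFilteredColimits [HasColimitsOfSize.{w, w} D] : Prop :=
  ∀ (J : Type w) [SmallCategory J] [IsFiltered J],
    PreservesFiniteProducts (colim : (J ⥤ D) ⥤ D)

end

end VarietyOfAlgebras

open VarietyOfAlgebras

/-! By Yoneda, a transformation `Hom(-, A) ⟶ Hom(C, Hom(-, A'))` is a family of morphisms `A l ⟶ A'
m`, one for each element of `C l` at `m`, natural in `l` and `m` (`elementwiseHomEquiv`). For an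
arbitrary functor `G : L ⥤ D` in place of `A'`, such families are corepresented by a functor given
by generators and relations (`exists_universal_elementwiseHom`). Its reflection into the
finite-product-preserving functors is `C ⊛ A` (`exists_circ_obj`).

The reflection (`exists_reflection`) iterates one construction: adjoin to `F` a morphism from each
product of values of `F` to the value at the product. In the colimit of the sequence the comparison
morphisms become invertible, because finite products commute with filtered colimits.

For `⊙`, a morphism of algebras `B ⟶ Hom(X, A)` is a cone with apex `X` over `A` indexed by the
elements of `B`, so a limit represents these morphisms. Taking `B = C l` for every `l` gives `C ⊙
A`.

The statements about `T` are formal. Under the adjunction, precomposition with `(T ⊙ T) ⊛ A ⟶ T ⊛ (T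
⊛ A)` becomes composition with the inverse of `(T ⊙ T) ⊙ B ≅ T ⊙ (T ⊙ B)`, so Yoneda gives
invertibility, and the action axioms transpose to the co-action axioms. -/

namespace VarietyOfAlgebras

/-! ### Functors given by generators and relations; one step of the reflection. -/

section Reflection

variable {L : Type w} [SmallCategory L] {D : Type u} [Category.{w} D]
  [HasColimitsOfSize.{w, w} D]

/-- The free functor `L ⥤ D` on a small family of generators, the generator `j` being an object
`Z j` of `D` placed at the object `y j` of `L`. -/
theorem exists_free (J : Type w) (y : J → L) (Z : J → D) :
    ∃ (H : L ⥤ D) (ι : ∀ j, Z j ⟶ H.obj (y j)), ∀ (G : L ⥤ D) (k : ∀ j, Z j ⟶ G.obj (y j)),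
      ∃! φ : H ⟶ G, ∀ j, ι j ≫ φ.app (y j) = k j := by
  -- Evaluation at `y j` has a left adjoint, formed from copowers of `Z j` by the hom-sets out of `y
  -- j`; the free functor is the coproduct of its values at the `Z j`.
  let e (j : J) (G : L ⥤ D) := (evaluationAdjunctionRight D (y j)).homEquiv (Z j) G
  have he (j : J) {G G' : L ⥤ D} (f : (evaluationLeftAdjoint D (y j)).obj (Z j) ⟶ G)
      (g : G ⟶ G') : e j G' (f ≫ g) = e j G f ≫ g.app (y j) :=
    (evaluationAdjunctionRight D (y j)).homEquiv_naturality_right f g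
  refine ⟨∐ fun j => (evaluationLeftAdjoint D (y j)).obj (Z j),
    fun j => e j _ (Sigma.ι (fun j => (evaluationLeftAdjoint D (y j)).obj (Z j)) j),
    fun G k => ⟨Sigma.desc fun j => (e j G).symm (k j), fun j => ?_, fun φ hφ => ?_⟩⟩
  · rw [← he, Sigma.ι_desc, Equiv.apply_symm_apply]
  · refine Sigma.hom_ext _ _ fun j => ?_
    rw [Sigma.ι_desc, Equiv.eq_symm_apply, he, hφ]

/-- The quotient of a functor `L ⥤ D` by a small family of relations. -/
theorem exists_quotient (H : L ⥤ D) {K : Type w} (y : K → L) (Z : K → D)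
    (a b : ∀ k, Z k ⟶ H.obj (y k)) :
    ∃ (Q : L ⥤ D) (π : H ⟶ Q), (∀ k, a k ≫ π.app (y k) = b k ≫ π.app (y k)) ∧
      ∀ (G : L ⥤ D) (φ : H ⟶ G), (∀ k, a k ≫ φ.app (y k) = b k ≫ φ.app (y k)) →
        ∃! φ' : Q ⟶ G, π ≫ φ' = φ := by
  -- The relations become two morphisms out of a free functor; the quotient is their coequalizer.
  obtain ⟨R, ι, hR⟩ := exists_free K y Z
  obtain ⟨α, hα, -⟩ := hR H a
  obtain ⟨β, hβ, -⟩ := hR H b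
  refine ⟨coequalizer α β, coequalizer.π α β, fun k => ?_, fun G φ h => ?_⟩
  · rw [← hα k, ← hβ k, Category.assoc, Category.assoc, ← NatTrans.comp_app,
      coequalizer.condition, NatTrans.comp_app]
  · have h' : α ≫ φ = β ≫ φ := by
      refine (hR G fun k => a k ≫ φ.app (y k)).unique (fun k => ?_) (fun k => ?_)
      · rw [NatTrans.comp_app, ← Category.assoc, hα]
      · rw [NatTrans.comp_app, ← Category.assoc, hβ, h]
    exact ⟨coequalizer.desc φ h', coequalizer.π_desc _ _, fun ψ hψ =>
      coequalizer.hom_ext (hψ.trans (coequalizer.π_desc _ _).symm)⟩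

/-- The functor `L ⥤ D` given by a small family of generators and a small family of relations. -/
theorem exists_presented {J : Type w} (y : J → L) (Z : J → D) {K : Type w} (y' : K → L)
    (Z' : K → D)
    (a b : ∀ (G : L ⥤ D), (∀ j, Z j ⟶ G.obj (y j)) → ∀ k, Z' k ⟶ G.obj (y' k))
    (ha : ∀ {G G' : L ⥤ D} (φ : G ⟶ G') (t : ∀ j, Z j ⟶ G.obj (y j)) (k : K),
      a G' (fun j => t j ≫ φ.app (y j)) k = a G t k ≫ φ.app (y' k))
    (hb : ∀ {G G' : L ⥤ D} (φ : G ⟶ G') (t : ∀ j, Z j ⟶ G.obj (y j)) (k : K),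
      b G' (fun j => t j ≫ φ.app (y j)) k = b G t k ≫ φ.app (y' k)) :
    ∃ (H : L ⥤ D) (ι : ∀ j, Z j ⟶ H.obj (y j)), (∀ k, a H ι k = b H ι k) ∧
      ∀ (G : L ⥤ D) (t : ∀ j, Z j ⟶ G.obj (y j)), (∀ k, a G t k = b G t k) →
        ∃! φ : H ⟶ G, ∀ j, ι j ≫ φ.app (y j) = t j := by
  -- Relations are operations natural in `G`, so they can be imposed on the generic family `ι` and
  -- carried to any other family by `ha` and `hb`.
  obtain ⟨H, ι, hH⟩ := exists_free J y Z
  obtain ⟨Q, π, hπ, hQ⟩ := exists_quotient H y' Z' (a H ι) (b H ι)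
  refine ⟨Q, fun j => ι j ≫ π.app (y j), fun k => by rw [ha, hb, hπ], fun G t ht => ?_⟩
  obtain ⟨φ, hφ, hφ'⟩ := hH G t
  obtain ⟨φ', h, h'⟩ := hQ G φ fun k => by rw [← ha, ← hb, funext hφ, ht]
  refine ⟨φ', fun j => ?_, fun ψ hψ => h' _ (hφ' _ fun j => ?_)⟩
  · rw [Category.assoc, ← NatTrans.comp_app, h, hφ]
  · rw [NatTrans.comp_app, ← Category.assoc, hψ]

variable [HasFiniteProducts L] [HasFiniteProducts D]

/-- One step towards the reflection of `F` into the finite-product-preserving functors: a functor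
under `F` to which the products of values of `F` are mapped as they should be, and which is
universal as far as morphisms to finite-product-preserving functors are concerned. -/
theorem exists_step (F : L ⥤ D) :
    ∃ (R : L ⥤ D) (η : F ⟶ R)
      (ψ : ∀ (n : ℕ) (m : Fin n → L), (∏ᶜ fun i => F.obj (m i)) ⟶ R.obj (∏ᶜ m)),
      (∀ n m i, ψ n m ≫ R.map (Pi.π m i) = Pi.π (fun i => F.obj (m i)) i ≫ η.app (m i)) ∧
      (∀ n m, piComparison F m ≫ ψ n m = η.app (∏ᶜ m)) ∧
      ∀ (G : L ⥤ D) [PreservesFiniteProducts G] (φ : F ⟶ G), ∃! φ' : R ⟶ G, η ≫ φ' = φ := by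
  -- Generators: `F l` at `l`, and a product of values of `F` at the product of their indices.
  -- Relations: naturality of `η`, the projections of `ψ`, and the agreement of `ψ` with `η` along
  -- the comparison morphism.
  let y : L ⊕ (Σ n : ULift.{w} ℕ, Fin n.down → L) → L := Sum.elim id fun p => ∏ᶜ p.2
  let Z : L ⊕ (Σ n : ULift.{w} ℕ, Fin n.down → L) → D :=
    Sum.elim F.obj fun p => ∏ᶜ fun i => F.obj (p.2 i)
  let y' : (Σ l m : L, l ⟶ m) ⊕ (Σ n : ULift.{w} ℕ, Σ _ : Fin n.down → L, Fin n.down) ⊕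
      (Σ n : ULift.{w} ℕ, Fin n.down → L) → L :=
    Sum.elim (fun p => p.2.1) (Sum.elim (fun p => p.2.1 p.2.2) fun p => ∏ᶜ p.2)
  let Z' : (Σ l m : L, l ⟶ m) ⊕ (Σ n : ULift.{w} ℕ, Σ _ : Fin n.down → L, Fin n.down) ⊕
      (Σ n : ULift.{w} ℕ, Fin n.down → L) → D :=
    Sum.elim (fun p => F.obj p.1)
      (Sum.elim (fun p => ∏ᶜ fun i => F.obj (p.2.1 i)) fun p => F.obj (∏ᶜ p.2))
  let a (G : L ⥤ D) (t : ∀ j, Z j ⟶ G.obj (y j)) : ∀ k, Z' k ⟶ G.obj (y' k)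
    | .inl p => t (.inl p.1) ≫ G.map p.2.2
    | .inr (.inl p) => t (.inr ⟨p.1, p.2.1⟩) ≫ G.map (Pi.π p.2.1 p.2.2)
    | .inr (.inr p) => piComparison F p.2 ≫ t (.inr p)
  let b (G : L ⥤ D) (t : ∀ j, Z j ⟶ G.obj (y j)) : ∀ k, Z' k ⟶ G.obj (y' k)
    | .inl p => F.map p.2.2 ≫ t (.inl p.2.1)
    | .inr (.inl p) => Pi.π (fun i => F.obj (p.2.1 i)) p.2.2 ≫ t (.inl (p.2.1 p.2.2))
    | .inr (.inr p) => t (.inl (∏ᶜ p.2))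
  obtain ⟨R, ι, hι, hR⟩ := exists_presented y Z y' Z' a b
    (fun φ t k => by
      rcases k with p | p | p
      · exact (Category.assoc _ _ _).trans ((congrArg _ (φ.naturality _).symm).trans
          (Category.assoc _ _ _).symm)
      · exact (Category.assoc _ _ _).trans ((congrArg _ (φ.naturality _).symm).trans
          (Category.assoc _ _ _).symm)
      · exact (Category.assoc _ _ _).symm)
    (fun φ t k => by
      rcases k with p | p | p
      · exact (Category.assoc _ _ _).symm
      · exact (Category.assoc _ _ _).symm
      · rfl)
  refine ⟨R, { app := fun l => ι (.inl l),
               naturality := fun l m f => (hι (.inl ⟨l, m, f⟩)).symm },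
    fun n m => ι (.inr ⟨⟨n⟩, m⟩), fun n m i => hι (.inr (.inl ⟨⟨n⟩, m, i⟩)),
    fun n m => hι (.inr (.inr ⟨⟨n⟩, m⟩)), fun G _ φ => ?_⟩
  -- The projections force this value on the product generators, since the comparison morphism of
  -- `G` is invertible.
  let s (n : ℕ) (m : Fin n → L) : (∏ᶜ fun i => F.obj (m i)) ⟶ G.obj (∏ᶜ m) :=
    Limits.Pi.map (fun i => φ.app (m i)) ≫ inv (piComparison G m)
  let t : ∀ j, Z j ⟶ G.obj (y j)
    | .inl l => φ.app l
    | .inr p => s p.1.down p.2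
  obtain ⟨φ', h, h'⟩ := hR G t (by
    rintro (p | p | p)
    · exact (φ.naturality p.2.2).symm
    · change (Limits.Pi.map (fun i => φ.app (p.2.1 i)) ≫ inv (piComparison G p.2.1)) ≫
        G.map (Pi.π p.2.1 p.2.2) = Pi.π (fun i => F.obj (p.2.1 i)) p.2.2 ≫ φ.app _
      simp
    · change piComparison F p.2 ≫ Limits.Pi.map (fun i => φ.app (p.2 i)) ≫ inv (piComparison G p.2) =
        φ.app _
      rw [← Category.assoc, IsIso.comp_inv_eq]
      refine Pi.hom_ext _ _ fun i => ?_
      simp [piComparison_comp_π_assoc])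
  refine ⟨φ', ?_, fun φ'' h'' => h' _ ?_⟩
  · ext l
    exact h (.inl l)
  · have h₁ (l : L) : ι (.inl l) ≫ φ''.app l = φ.app l := NatTrans.congr_app h'' l
    have key (n : ℕ) (m : Fin n → L) (ψ : (∏ᶜ fun i => F.obj (m i)) ⟶ R.obj (∏ᶜ m))
        (h₂ : ∀ i, (ψ ≫ R.map (Pi.π m i)) ≫ φ''.app _ =
          Pi.π (fun i => F.obj (m i)) i ≫ φ.app (m i)) :
        ψ ≫ φ''.app (∏ᶜ m) = s n m := by
      rw [IsIso.eq_comp_inv]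
      refine Pi.hom_ext _ _ fun i => ?_
      simpa using h₂ i
    rintro (l | p)
    · exact h₁ l
    · refine key p.1.down p.2 (ι (.inr p)) fun i => ?_
      exact (congrArg (· ≫ φ''.app (p.2 i)) (hι (.inr (.inl ⟨p.1, p.2, i⟩)))).trans
        ((Category.assoc _ _ _).trans (congrArg _ (h₁ _)))

end Reflection

/-! ### Sequential colimits of functors and the reflection. -/

section Reflection

variable {L : Type w} [SmallCategory L] {D : Type u} [Category.{w} D]

/-- A transformation of functors on `AsSmall ℕ` into a constant functor, from its compatibility
with the steps of the sequence. -/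
def sequenceCocone (P : AsSmall.{w} ℕ ⥤ D) (X : D) (χ : ∀ k : ℕ, P.obj (AsSmall.up.obj k) ⟶ X)
    (h : ∀ k, P.map (AsSmall.up.map (homOfLE (k.le_add_right 1))) ≫ χ (k + 1) = χ k) :
    Cocone P :=
  let α : AsSmall.up ⋙ P ⟶ (Functor.const ℕ).obj X :=
    NatTrans.ofSequence χ fun k => (h k).trans (Category.comp_id _).symm
  { pt := X
    ι := { app := fun j => α.app (ULift.down j)
           naturality := fun _ _ f => α.naturality f.down } }

theorem sequence_hom_ext [HasColimitsOfSize.{w, w} D] {P : AsSmall.{w} ℕ ⥤ D} {X : D}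
    {f g : colimit P ⟶ X}
    (h : ∀ k : ℕ, colimit.ι P (AsSmall.up.obj k) ≫ f = colimit.ι P (AsSmall.up.obj k) ≫ g) :
    f = g :=
  colimit.hom_ext fun j => h (ULift.down j)

section

variable (X : ℕ → L ⥤ D) (η : ∀ k, X k ⟶ X (k + 1))

/-- A sequence of functors, as a diagram indexed by a small category in any universe. -/
def sequenceDiagram : AsSmall.{w} ℕ ⥤ L ⥤ D := AsSmall.down ⋙ Functor.ofSequence η

theorem sequenceDiagram_map (k : ℕ) :
    (sequenceDiagram X η).map (AsSmall.up.map (homOfLE (k.le_add_right 1))) = η k :=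
  Functor.ofSequence_map_homOfLE_succ η k

variable [HasColimitsOfSize.{w, w} D]

/-- The colimit of a sequence of functors. -/
noncomputable def sequenceColimit : L ⥤ D := (sequenceDiagram X η).flip ⋙ colim

/-- The morphism from a member of a sequence of functors to the colimit. -/
noncomputable def sequenceColimitι (k : ℕ) : X k ⟶ sequenceColimit X η where
  app l := colimit.ι ((sequenceDiagram X η).flip.obj l) (AsSmall.up.obj k)
  naturality _ _ f :=
    (ι_colimMap ((sequenceDiagram X η).flip.map f) (AsSmall.up.obj k)).symm

theorem sequenceColimitι_step (k : ℕ) :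
    η k ≫ sequenceColimitι X η (k + 1) = sequenceColimitι X η k := by
  ext l
  have h := colimit.w ((sequenceDiagram X η).flip.obj l)
    (AsSmall.up.map (homOfLE (k.le_add_right 1)))
  have h' : ((sequenceDiagram X η).flip.obj l).map
    (AsSmall.up.map (homOfLE (k.le_add_right 1))) = (η k).app l :=
    NatTrans.congr_app (sequenceDiagram_map X η k) l
  rw [h'] at h
  exact h

theorem sequenceColimit_hom_ext {G : L ⥤ D} {f g : sequenceColimit X η ⟶ G}
    (h : ∀ k, sequenceColimitι X η k ≫ f = sequenceColimitι X η k ≫ g) : f = g := by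
  ext l
  exact sequence_hom_ext (fun k => NatTrans.congr_app (h k) l)

theorem exists_sequenceColimit_desc {G : L ⥤ D} (φ : ∀ k, X k ⟶ G)
    (h : ∀ k, η k ≫ φ (k + 1) = φ k) :
    ∃ φ' : sequenceColimit X η ⟶ G, ∀ k, sequenceColimitι X η k ≫ φ' = φ k := by
  let c (l : L) : Cocone ((sequenceDiagram X η).flip.obj l) :=
    sequenceCocone _ (G.obj l) (fun k => (φ k).app l) fun k => by
      have h' : ((sequenceDiagram X η).flip.obj l).map
        (AsSmall.up.map (homOfLE (k.le_add_right 1))) = (η k).app l :=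
        NatTrans.congr_app (sequenceDiagram_map X η k) l
      rw [h']
      exact NatTrans.congr_app (h k) l
  have hd (l : L) : ∃ d : (sequenceColimit X η).obj l ⟶ G.obj l,
      ∀ k, (sequenceColimitι X η k).app l ≫ d = (φ k).app l :=
    ⟨colimit.desc _ (c l), fun k => colimit.ι_desc (c l) (AsSmall.up.obj k)⟩
  choose d hc using hd
  refine ⟨{ app := d, naturality := fun l m f => ?_ }, fun k => ?_⟩
  · refine sequence_hom_ext fun k => ?_
    change (sequenceColimitι X η k).app l ≫ (sequenceColimit X η).map f ≫ _ =
      (sequenceColimitι X η k).app l ≫ _ ≫ _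
    rw [← Category.assoc, ← Category.assoc, hc, ← (sequenceColimitι X η k).naturality,
      Category.assoc, hc, (φ k).naturality]
  · ext l
    exact hc l k

variable [HasFiniteProducts L] [HasFiniteProducts D]

/-- The morphisms `ψ k` lead from the product at stage `k` back to stage `k + 1`, so they interleave
with the comparison morphisms and invert them in the colimit. -/
theorem preservesFiniteProducts_sequenceColimit
    (hcomm : FiniteProductsCommuteWithFilteredColimits D)
    (ψ : ∀ (k n : ℕ) (m : Fin n → L), (∏ᶜ fun i => (X k).obj (m i)) ⟶ (X (k + 1)).obj (∏ᶜ m))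
    (h₁ : ∀ k n m i, ψ k n m ≫ (X (k + 1)).map (Pi.π m i) =
      Pi.π (fun i => (X k).obj (m i)) i ≫ (η k).app (m i))
    (h₂ : ∀ k n m, piComparison (X k) m ≫ ψ k n m = (η k).app (∏ᶜ m)) :
    PreservesFiniteProducts (sequenceColimit X η) where
  preserves n := by
    refine ⟨fun {K} => ?_⟩
    suffices h : ∀ m : Fin n → L, PreservesLimit (Discrete.functor m) (sequenceColimit X η) from
      have := h fun i => K.obj ⟨i⟩
      preservesLimit_of_iso_diagram _ (Discrete.natIsoFunctor (F := K)).symm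
    intro m
    let W := (sequenceDiagram X η).flip
    have : PreservesFiniteProducts (colim : (AsSmall.{w} ℕ ⥤ D) ⥤ D) := hcomm _
    have hiso : IsIso (colim.map (piComparison W m)) := by
      let P : AsSmall.{w} ℕ ⥤ D := ∏ᶜ fun i => W.obj (m i)
      let q (k : ℕ) (i : Fin n) : P.obj (AsSmall.up.obj k) ⟶ (X k).obj (m i) :=
        (Pi.π (fun i => W.obj (m i)) i).app (AsSmall.up.obj k)
      -- Products of diagrams are computed stagewise, so the projections at stage `k` are jointly
      -- monic.
      have q_ext (k : ℕ) {Z : D} {f g : Z ⟶ P.obj (AsSmall.up.obj k)}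
          (h : ∀ i, f ≫ q k i = g ≫ q k i) : f = g := by
        let ev := (evaluation (AsSmall.{w} ℕ) D).obj (AsSmall.up.obj k)
        refine (cancel_mono (piComparison ev fun i => W.obj (m i))).1
          (Pi.hom_ext _ _ fun i => ?_)
        exact (Category.assoc _ _ _).trans ((congrArg (f ≫ ·) (piComparison_comp_π ev _ i)).trans
          ((h i).trans ((congrArg (g ≫ ·) (piComparison_comp_π ev _ i)).symm.trans
            (Category.assoc _ _ _).symm)))
      -- The candidate inverse raises the stage by one; hence its composites with `κ` are transition
      -- morphisms, which become identities in the colimit.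
      let χ (k : ℕ) : P.obj (AsSmall.up.obj k) ⟶ (X (k + 1)).obj (∏ᶜ m) :=
        Pi.lift (q k) ≫ ψ k n m
      have q_step (k : ℕ) (i : Fin n) :
          P.map (AsSmall.up.map (homOfLE (k.le_add_right 1))) ≫ q (k + 1) i =
            q k i ≫ (η k).app (m i) :=
        ((Pi.π (fun i => W.obj (m i)) i).naturality _).trans
          (congrArg (q k i ≫ ·) (NatTrans.congr_app (sequenceDiagram_map X η k) (m i)))
      have χ_π (k : ℕ) (i : Fin n) :
          χ k ≫ (X (k + 1)).map (Pi.π m i) = q k i ≫ (η k).app (m i) := by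
        simp [χ, h₁]
      -- By `h₂` both sides end in `ψ (k + 1)`, and what precedes it can be compared on projections.
      have χ_step (k : ℕ) : P.map (AsSmall.up.map (homOfLE (k.le_add_right 1))) ≫ χ (k + 1) =
          χ k ≫ (η (k + 1)).app (∏ᶜ m) := by
        rw [← h₂]
        simp only [χ, ← Category.assoc]
        congr 1
        refine Pi.hom_ext _ _ fun i => ?_
        rw [Category.assoc, Category.assoc, Pi.lift_π, q_step, piComparison_comp_π]
        exact (χ_π k i).symm
      let κ (k : ℕ) : (X k).obj (∏ᶜ m) ⟶ P.obj (AsSmall.up.obj k) :=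
        (piComparison W m).app (AsSmall.up.obj k)
      have κ_π (k : ℕ) (i : Fin n) : κ k ≫ q k i = (X k).map (Pi.π m i) :=
        NatTrans.congr_app (piComparison_comp_π W m i) (AsSmall.up.obj k)
      have κχ (k : ℕ) : κ k ≫ χ k = (η k).app (∏ᶜ m) := by
        rw [← h₂]
        simp only [χ, ← Category.assoc]
        congr 1
        refine Pi.hom_ext _ _ fun i => ?_
        simp [κ_π]
      have χκ (k : ℕ) : χ k ≫ κ (k + 1) =
          P.map (AsSmall.up.map (homOfLE (k.le_add_right 1))) :=
        q_ext _ fun i => by rw [Category.assoc, κ_π, χ_π, q_step]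
      let c : Cocone P := sequenceCocone P ((sequenceColimit X η).obj (∏ᶜ m))
        (fun k => χ k ≫ (sequenceColimitι X η (k + 1)).app (∏ᶜ m)) fun k => by
          rw [← Category.assoc, χ_step, Category.assoc, ← NatTrans.comp_app,
            sequenceColimitι_step]
      obtain ⟨d, hd⟩ : ∃ d : colimit P ⟶ (sequenceColimit X η).obj (∏ᶜ m),
          ∀ k : ℕ, colimit.ι P (AsSmall.up.obj k) ≫ d =
            χ k ≫ (sequenceColimitι X η (k + 1)).app (∏ᶜ m) :=
        ⟨colimit.desc P c, fun k => colimit.ι_desc c (AsSmall.up.obj k)⟩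
      obtain ⟨e, he, hκ⟩ : ∃ e : (sequenceColimit X η).obj (∏ᶜ m) ⟶ colimit P,
          e = colim.map (piComparison W m) ∧ ∀ k : ℕ,
            (sequenceColimitι X η k).app (∏ᶜ m) ≫ e = κ k ≫ colimit.ι P (AsSmall.up.obj k) :=
        ⟨_, rfl, fun k => ι_colimMap (piComparison W m) (AsSmall.up.obj k)⟩
      have h_ext {f g : (sequenceColimit X η).obj (∏ᶜ m) ⟶ (sequenceColimit X η).obj (∏ᶜ m)}
          (h : ∀ k, (sequenceColimitι X η k).app (∏ᶜ m) ≫ f =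
            (sequenceColimitι X η k).app (∏ᶜ m) ≫ g) : f = g := sequence_hom_ext h
      have : IsIso e := by
        refine ⟨d, h_ext fun k => ?_, sequence_hom_ext fun k => ?_⟩
        · rw [← Category.assoc, hκ, Category.assoc, hd, ← Category.assoc, κχ, Category.comp_id,
            ← NatTrans.comp_app, sequenceColimitι_step]
        · rw [← Category.assoc, hd, Category.assoc, hκ, ← Category.assoc, χκ, Category.comp_id,
            colimit.w]
      exact he ▸ this
    have : IsIso (piComparison (sequenceColimit X η) m) := by
      -- The first factor is invertible by the interleaving, the second because `colim` preserves
      -- finite products.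
      have h : piComparison (sequenceColimit X η) m = colim.map (piComparison W m) ≫
          piComparison colim (fun i => W.obj (m i)) := by
        refine Pi.hom_ext _ _ fun i => ?_
        refine (piComparison_comp_π _ m i).trans (Eq.trans ?_ (Category.assoc _ _ _).symm)
        refine Eq.trans ?_
          (congrArg (colim.map (piComparison W m) ≫ ·) (piComparison_comp_π colim _ i)).symm
        refine Eq.trans ?_ (colim.map_comp _ _)
        rw [piComparison_comp_π]
        rfl
      rw [h]
      have : PreservesLimit (Discrete.functor fun i => W.obj (m i))
        (colim : (AsSmall.{w} ℕ ⥤ D) ⥤ D) := inferInstance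
      have h' : IsIso (piComparison (colim : (AsSmall.{w} ℕ ⥤ D) ⥤ D) fun i => W.obj (m i)) :=
        inferInstance
      exact IsIso.comp_isIso' hiso h'
    exact PreservesProduct.of_iso_comparison _ _

end

variable [HasColimitsOfSize.{w, w} D] [HasFiniteProducts L] [HasFiniteProducts D]

/-- The finite-product-preserving functors are reflective among all functors `L ⥤ D`. -/
theorem exists_reflection (hcomm : FiniteProductsCommuteWithFilteredColimits D) (F : L ⥤ D) :
    ∃ (R : L ⥤ D) (_ : PreservesFiniteProducts R) (η : F ⟶ R),
      ∀ (G : L ⥤ D) [PreservesFiniteProducts G] (φ : F ⟶ G), ∃! φ' : R ⟶ G, η ≫ φ' = φ := by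
  choose R η ψ h₁ h₂ hR using exists_step (L := L) (D := D)
  let X (k : ℕ) : L ⥤ D := Nat.rec F (fun _ G => R G) k
  let θ (k : ℕ) : X k ⟶ X (k + 1) := η (X k)
  refine ⟨sequenceColimit X θ, preservesFiniteProducts_sequenceColimit X θ hcomm
    (fun k => ψ (X k)) (fun k => h₁ (X k)) (fun k => h₂ (X k)), sequenceColimitι X θ 0,
    fun G _ φ => ?_⟩
  -- A morphism to `G` extends over each stage in turn; uniqueness at each stage gives uniqueness on
  -- the colimit.
  choose s hs using fun (k : ℕ) (f : X k ⟶ G) => (hR (X k) G f).exists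
  let φs (k : ℕ) : X k ⟶ G := Nat.rec (motive := fun k => X k ⟶ G) φ (fun k f => s k f) k
  obtain ⟨φ', hφ'⟩ := exists_sequenceColimit_desc X θ φs fun k => hs k (φs k)
  refine ⟨φ', hφ' 0, fun φ'' h => sequenceColimit_hom_ext X θ fun k => ?_⟩
  induction k with
  | zero => exact h.trans (hφ' 0).symm
  | succ k ih =>
    refine (hR (X k) G (sequenceColimitι X θ k ≫ φ')).unique ?_ ?_
    · exact (Category.assoc _ _ _).symm.trans
        ((congrArg (· ≫ φ'') (sequenceColimitι_step X θ k)).trans ih)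
    · exact (Category.assoc _ _ _).symm.trans
        (congrArg (· ≫ φ') (sequenceColimitι_step X θ k))

end Reflection

/-! ### Bifunctors obtained from pointwise representability, in abstract categories. -/

section Bifunctors

universe v₁ v₂ v₃ u₁ u₂ u₃

variable {𝒞 : Type u₁} [Category.{v₁} 𝒞] {ℬ : Type u₂} [Category.{v₂} ℬ]
  {𝒲 : Type u₃} [Category.{v₃} 𝒲] (h : ℬ ⥤ 𝒲) (K : 𝒞ᵒᵖ ⥤ ℬ ⥤ 𝒲)

/-- A bifunctor `circ` with natural bijections `Hom(circ C A, A') ≅ Hom(h A, K C A')`. -/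
structure RelativeAdjunction (circ : 𝒞 ⥤ ℬ ⥤ ℬ) where
  /-- The bijection. -/
  homEquiv (C : 𝒞) (A A' : ℬ) : ((circ.obj C).obj A ⟶ A') ≃ (h.obj A ⟶ (K.obj (op C)).obj A')
  naturality_one {C C' : 𝒞} (f : C ⟶ C') {A A' : ℬ} (g : (circ.obj C').obj A ⟶ A') :
    homEquiv C A A' ((circ.map f).app A ≫ g) = homEquiv C' A A' g ≫ (K.map f.op).app A'
  naturality_two (C : 𝒞) {A B A' : ℬ} (f : A ⟶ B) (g : (circ.obj C).obj B ⟶ A') :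
    homEquiv C A A' ((circ.obj C).map f ≫ g) = h.map f ≫ homEquiv C B A' g
  naturality_three (C : 𝒞) {A A' B' : ℬ} (g : (circ.obj C).obj A ⟶ A') (f : A' ⟶ B') :
    homEquiv C A B' (g ≫ f) = homEquiv C A A' g ≫ (K.obj (op C)).map f

variable {h K}

/-- A bifunctor is determined up to isomorphism by a relative adjunction. -/
theorem RelativeAdjunction.nonempty_iso {circ circ' : 𝒞 ⥤ ℬ ⥤ ℬ}
    (Φ : RelativeAdjunction h K circ) (Φ' : RelativeAdjunction h K circ') :
    Nonempty (circ' ≅ circ) := by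
  let e (C : 𝒞) (A A' : ℬ) := (Φ'.homEquiv C A A').trans (Φ.homEquiv C A A').symm
  have he (C : 𝒞) (A A' B' : ℬ) (g : (circ'.obj C).obj A ⟶ A') (f : A' ⟶ B') :
      e C A B' (g ≫ f) = e C A A' g ≫ f := by
    simp [e, Equiv.symm_apply_eq, Φ.naturality_three, Φ'.naturality_three]
  have he' (C : 𝒞) (A A' B' : ℬ) (g : (circ.obj C).obj A ⟶ A') (f : A' ⟶ B') :
      (e C A B').symm (g ≫ f) = (e C A A').symm g ≫ f := by
    rw [Equiv.symm_apply_eq, he, Equiv.apply_symm_apply]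
  let i (C : 𝒞) (A : ℬ) : (circ'.obj C).obj A ≅ (circ.obj C).obj A :=
    { hom := (e C A _).symm (𝟙 _)
      inv := e C A _ (𝟙 _)
      hom_inv_id := by rw [← he', Category.id_comp, Equiv.symm_apply_apply]
      inv_hom_id := by rw [← he, Category.id_comp, Equiv.apply_symm_apply] }
  have hi (C : 𝒞) (A A' : ℬ) (g : (circ.obj C).obj A ⟶ A') :
      (i C A).hom ≫ g = (e C A A').symm g := by
    simp only [i]
    rw [← he', Category.id_comp]
  refine ⟨NatIso.ofComponents (fun C => NatIso.ofComponents (i C) fun {A B} f => ?_)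
    fun {C C'} f => ?_⟩
  · rw [hi, Equiv.eq_symm_apply]
    have h₁ (g : (circ'.obj C).obj B ⟶ (circ.obj C).obj B) :
        e C A _ ((circ'.obj C).map f ≫ g) = (circ.obj C).map f ≫ e C B _ g := by
      simp [e, Equiv.symm_apply_eq, Φ.naturality_two, Φ'.naturality_two]
    rw [h₁, Equiv.apply_symm_apply, Category.comp_id]
  · ext A
    have h₁ (g : (circ'.obj C').obj A ⟶ (circ.obj C').obj A) :
        e C A _ ((circ'.map f).app A ≫ g) = (circ.map f).app A ≫ e C' A _ g := by
      simp [e, Equiv.symm_apply_eq, Φ.naturality_one, Φ'.naturality_one]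
    change (circ'.map f).app A ≫ (i C' A).hom = (i C A).hom ≫ (circ.map f).app A
    rw [hi, Equiv.eq_symm_apply, h₁, Equiv.apply_symm_apply, Category.comp_id]

variable (h K)

/-- Objects corepresenting the functors `Hom(h A, K C -)` form a bifunctor. -/
theorem exists_relativeAdjunction
    (H : ∀ (C : 𝒞) (A : ℬ), ∃ (X : ℬ) (e : ∀ A', (X ⟶ A') ≃ (h.obj A ⟶ (K.obj (op C)).obj A')),
      ∀ (A' B' : ℬ) (g : X ⟶ A') (f : A' ⟶ B'),
        e B' (g ≫ f) = e A' g ≫ (K.obj (op C)).map f) :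
    ∃ circ : 𝒞 ⥤ ℬ ⥤ ℬ, Nonempty (RelativeAdjunction h K circ) := by
  choose X e he using H
  -- The universal element is `e` at the identity; `r` and `l` classify its translates under `h.map
  -- f` and `K.map f.op`. Functoriality is then checked after applying the injection `e`.
  let r (C : 𝒞) {A B : ℬ} (f : A ⟶ B) : X C A ⟶ X C B :=
    (e C A _).symm (h.map f ≫ e C B _ (𝟙 _))
  let l {C C' : 𝒞} (f : C ⟶ C') (A : ℬ) : X C A ⟶ X C' A :=
    (e C A _).symm (e C' A _ (𝟙 _) ≫ (K.map f.op).app _)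
  have hr (C : 𝒞) {A B A' : ℬ} (f : A ⟶ B) (g : X C B ⟶ A') :
      e C A A' (r C f ≫ g) = h.map f ≫ e C B A' g := by
    rw [he, Equiv.apply_symm_apply, Category.assoc, ← he, Category.id_comp]
  have hl {C C' : 𝒞} (f : C ⟶ C') {A A' : ℬ} (g : X C' A ⟶ A') :
      e C A A' (l f A ≫ g) = e C' A A' g ≫ (K.map f.op).app A' := by
    rw [he, Equiv.apply_symm_apply, Category.assoc, ← NatTrans.naturality, ← Category.assoc,
      ← he, Category.id_comp]
  have hr' (C : 𝒞) {A B : ℬ} (f : A ⟶ B) : e C A _ (r C f) = h.map f ≫ e C B _ (𝟙 _) :=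
    Equiv.apply_symm_apply _ _
  have hl' {C C' : 𝒞} (f : C ⟶ C') (A : ℬ) :
      e C A _ (l f A) = e C' A _ (𝟙 _) ≫ (K.map f.op).app _ := Equiv.apply_symm_apply _ _
  let circ : 𝒞 ⥤ ℬ ⥤ ℬ :=
    { obj := fun C =>
        { obj := X C
          map := fun f => r C f
          map_id := fun A => (e C A _).injective (by simp [hr'])
          map_comp := fun f g => (e C _ _).injective (by simp [hr, hr']) }
      map := fun f =>
        { app := l f
          naturality := fun A B g => (e _ _ _).injective (by simp [hr, hl, hr', hl']) }
      map_id := fun C => by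
        ext A
        exact (e C A _).injective (by simp [hl'])
      map_comp := fun f g => by
        ext A
        exact (e _ A _).injective (by simp [hl, hl']) }
  exact ⟨circ, ⟨{ homEquiv := e, naturality_one := hl, naturality_two := hr,
                  naturality_three := fun C _ _ _ g f => he C _ _ _ g f }⟩⟩

/-- Objects representing the values of a bifunctor form a bifunctor. -/
theorem exists_bifunctor (hh : h.FullyFaithful)
    (H : ∀ (C : 𝒞) (A : ℬ), ∃ X : ℬ, Nonempty (h.obj X ≅ (K.obj (op C)).obj A)) :
    ∃ (F : 𝒞ᵒᵖ ⥤ ℬ ⥤ ℬ) (i : ∀ C A, h.obj ((F.obj (op C)).obj A) ≅ (K.obj (op C)).obj A),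
      (∀ {C C' : 𝒞} (f : C ⟶ C') (A : ℬ),
        h.map ((F.map f.op).app A) ≫ (i C A).hom = (i C' A).hom ≫ (K.map f.op).app A) ∧
      ∀ (C : 𝒞) {A A' : ℬ} (f : A ⟶ A'),
        h.map ((F.obj (op C)).map f) ≫ (i C A').hom = (i C A).hom ≫ (K.obj (op C)).map f := by
  choose X i using H
  replace i (C : 𝒞) (A : ℬ) := (i C A).some
  let r (C : 𝒞) {A B : ℬ} (f : A ⟶ B) : X C A ⟶ X C B :=
    hh.preimage ((i C A).hom ≫ (K.obj (op C)).map f ≫ (i C B).inv)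
  let l {C C' : 𝒞} (f : C ⟶ C') (A : ℬ) : X C' A ⟶ X C A :=
    hh.preimage ((i C' A).hom ≫ (K.map f.op).app A ≫ (i C A).inv)
  have hr (C : 𝒞) {A B : ℬ} (f : A ⟶ B) :
      h.map (r C f) = (i C A).hom ≫ (K.obj (op C)).map f ≫ (i C B).inv := hh.map_preimage _
  have hl {C C' : 𝒞} (f : C ⟶ C') (A : ℬ) :
      h.map (l f A) = (i C' A).hom ≫ (K.map f.op).app A ≫ (i C A).inv := hh.map_preimage _
  let F : 𝒞ᵒᵖ ⥤ ℬ ⥤ ℬ :=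
    { obj := fun C =>
        { obj := X C.unop
          map := fun f => r C.unop f
          map_id := fun A => hh.map_injective (by simp [hr])
          map_comp := fun f g => hh.map_injective (by simp [hr]) }
      map := fun f =>
        { app := l f.unop
          naturality := fun A B g => hh.map_injective (by simp [hr, hl]) }
      map_id := fun C => by
        ext A
        exact hh.map_injective (by simp [hl])
      map_comp := fun f g => by
        ext A
        exact hh.map_injective (by simp [hl]) }
  exact ⟨F, i, fun f A => by simp [F, hl], fun C _ _ f => by simp [F, hr]⟩

end Bifunctors

/-! ### Construction of `⊛`. -/

section Circ

variable {L : Type w} [SmallCategory L] {D : Type u} [Category.{w} D]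

/-- Families of morphisms `A l ⟶ G m` that are parametrized by the elements of `C` and natural in
both variables. -/
@[ext]
structure ElementwiseHom (C : CoAlg L) (A G : L ⥤ D) where
  /-- The morphism for an element of `C`. -/
  app (l m : L) (c : (C.unop.obj.obj l).unop.obj.obj m) : A.obj l ⟶ G.obj m
  naturality_right (l : L) {m m' : L} (g : m ⟶ m') (c : (C.unop.obj.obj l).unop.obj.obj m) :
    app l m c ≫ G.map g = app l m' ((C.unop.obj.obj l).unop.obj.map g c)
  naturality_left {l l' : L} (f : l ⟶ l') (m : L) (c : (C.unop.obj.obj l').unop.obj.obj m) :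
    A.map f ≫ app l' m c = app l m ((C.unop.obj.map f).unop.hom.app m c)

namespace ElementwiseHom

/-- Composition with a natural transformation. -/
@[simps]
def comp {C : CoAlg L} {A G G' : L ⥤ D} (t : ElementwiseHom C A G) (φ : G ⟶ G') :
    ElementwiseHom C A G' where
  app l m c := t.app l m c ≫ φ.app m
  naturality_right l m m' g c := by
    rw [Category.assoc, ← φ.naturality, ← Category.assoc, t.naturality_right]
  naturality_left f m c := by rw [← Category.assoc, t.naturality_left]

end ElementwiseHom

/-- The value at an element of a morphism of algebras into `Hom(X, A)`. -/
def homAlgEval {B : Variety L} {A : Models L D} {X : Dᵒᵖ} (k : B ⟶ homAlgObj A X) (m : L)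
    (b : B.obj.obj m) : X.unop ⟶ A.obj.obj m :=
  ConcreteCategory.hom (k.hom.app m) b

theorem homAlgEval_naturality {B : Variety L} {A : Models L D} {X : Dᵒᵖ}
    (k : B ⟶ homAlgObj A X) {m m' : L} (g : m ⟶ m') (b : B.obj.obj m) :
    homAlgEval k m b ≫ A.obj.map g = homAlgEval k m' (B.obj.map g b) :=
  (ConcreteCategory.congr_hom (k.hom.naturality g) b).symm

theorem homAlgEval_ext {B : Variety L} {A : Models L D} {X : Dᵒᵖ} {k k' : B ⟶ homAlgObj A X}
    (h : ∀ m b, homAlgEval k m b = homAlgEval k' m b) : k = k' := by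
  ext m b
  exact h m b

/-- A morphism of algebras into `Hom(X, A)`, from its values. -/
def homAlgMk {B : Variety L} {A : Models L D} {X : Dᵒᵖ}
    (v : ∀ m : L, B.obj.obj m → (X.unop ⟶ A.obj.obj m))
    (h : ∀ {m m' : L} (g : m ⟶ m') (b : B.obj.obj m), v m b ≫ A.obj.map g = v m' (B.obj.map g b)) :
    B ⟶ homAlgObj A X :=
  ObjectProperty.homMk
    { app := fun m => TypeCat.ofHom (v m)
      naturality := fun m m' g => by
        ext b
        exact (h g b).symm }

/-- The values of a morphism of algebra-valued functors `Hom(-, A) ⟶ Hom(C, Hom(-, A'))`. -/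
def covEval {C : CoAlg L} {A A' : Models L D}
    (θ : homAlg.obj A ⟶ homAlg.obj A' ⋙ cov.obj (op C)) (X : Dᵒᵖ) (l : L)
    (g : X.unop ⟶ A.obj.obj l) : (C.unop.obj.obj l).unop ⟶ homAlgObj A' X :=
  ConcreteCategory.hom ((θ.app X).hom.app l) g

theorem covEval_ext {C : CoAlg L} {A A' : Models L D}
    {θ θ' : homAlg.obj A ⟶ homAlg.obj A' ⋙ cov.obj (op C)}
    (h : ∀ X l g, covEval θ X l g = covEval θ' X l g) : θ = θ' := by
  ext X l g
  exact h X l g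

/-- This is the Yoneda step: `θ` is recovered from its values at the identities of the objects `A
l`. -/
theorem covEval_naturality {C : CoAlg L} {A A' : Models L D}
    (θ : homAlg.obj A ⟶ homAlg.obj A' ⋙ cov.obj (op C)) (X : Dᵒᵖ) (l : L)
    (g : X.unop ⟶ A.obj.obj l) (m : L) (c : (C.unop.obj.obj l).unop.obj.obj m) :
    homAlgEval (covEval θ X l g) m c =
      g ≫ homAlgEval (covEval θ (op (A.obj.obj l)) l (𝟙 _)) m c := by
  have h : covEval θ X l (g ≫ 𝟙 _) = covEval θ (op (A.obj.obj l)) l (𝟙 _) ≫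
      (homAlg.obj A').map g.op :=
    ConcreteCategory.congr_hom (NatTrans.congr_app
      (congrArg InducedCategory.Hom.hom (θ.naturality g.op)) l) (𝟙 (A.obj.obj l))
  rw [Category.comp_id] at h
  rw [h]
  rfl

theorem covEval_map {C : CoAlg L} {A A' : Models L D}
    (θ : homAlg.obj A ⟶ homAlg.obj A' ⋙ cov.obj (op C)) (X : Dᵒᵖ) {l l' : L} (f : l ⟶ l')
    (g : X.unop ⟶ A.obj.obj l) :
    covEval θ X l' (g ≫ A.obj.map f) = (C.unop.obj.map f).unop ≫ covEval θ X l g :=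
  ConcreteCategory.congr_hom ((θ.app X).hom.naturality f) g

/-- Families indexed by the elements of `C` as morphisms of algebra-valued functors. -/
def elementwiseHomEquiv (C : CoAlg L) (A A' : Models L D) :
    ElementwiseHom C A.obj A'.obj ≃ (homAlg.obj A ⟶ homAlg.obj A' ⋙ cov.obj (op C)) where
  toFun t :=
    { app := fun X => ObjectProperty.homMk
        { app := fun l => TypeCat.ofHom fun (g : X.unop ⟶ A.obj.obj l) =>
            (homAlgMk (fun m c => g ≫ t.app l m c) fun k c => by
              rw [Category.assoc, t.naturality_right] :
              (C.unop.obj.obj l).unop ⟶ homAlgObj A' X)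
          naturality := fun l l' f => by
            ext g
            refine homAlgEval_ext (B := (C.unop.obj.obj l').unop) (A := A') (X := X)
              fun m c => ?_
            change ((show X.unop ⟶ A.obj.obj l from g) ≫ A.obj.map f) ≫ t.app l' m c =
              (show X.unop ⟶ A.obj.obj l from g) ≫ t.app l m _
            rw [Category.assoc, t.naturality_left]
            rfl }
      naturality := fun X Y k => by
        ext l g
        refine homAlgEval_ext (B := (C.unop.obj.obj l).unop) (A := A') (X := Y) fun m c => ?_
        exact Category.assoc (obj := D) k.unop g (t.app l m c) }
  invFun θ :=
    { app := fun l => homAlgEval (covEval θ (op (A.obj.obj l)) l (𝟙 _))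
      naturality_right := fun l _ _ => homAlgEval_naturality _
      naturality_left := fun {l l'} f m c => by
        have h := covEval_map θ (op (A.obj.obj l)) f (𝟙 _)
        rw [Category.id_comp] at h
        rw [← covEval_naturality θ (op (A.obj.obj l)) l' (A.obj.map f), h]
        rfl }
  left_inv t := by
    ext l m c
    exact Category.id_comp (obj := D) (t.app l m c)
  right_inv θ := covEval_ext fun X l g =>
    homAlgEval_ext fun m c => (covEval_naturality θ X l g m c).symm

theorem elementwiseHomEquiv_comp (C : CoAlg L) {A A' A'' : Models L D}
    (t : ElementwiseHom C A.obj A'.obj) (f : A' ⟶ A'') :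
    elementwiseHomEquiv C A A'' (t.comp f.hom) =
      elementwiseHomEquiv C A A' t ≫ Functor.whiskerRight (homAlg.map f) (cov.obj (op C)) :=
  covEval_ext fun _ l g => homAlgEval_ext fun m c =>
    (Category.assoc (obj := D) g (t.app l m c) (f.hom.app m)).symm

section

variable [HasColimitsOfSize.{w, w} D]

/-- The functor that corepresents families indexed by the elements of `C`. -/
theorem exists_universal_elementwiseHom (C : CoAlg L) (A : L ⥤ D) :
    ∃ (F : L ⥤ D) (t : ElementwiseHom C A F), ∀ (G : L ⥤ D) (s : ElementwiseHom C A G),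
      ∃! φ : F ⟶ G, t.comp φ = s := by
  -- Each element `c` of `C l` at `m` contributes a generator `A l` placed at `m`; the relations in
  -- `K` are the two naturality conditions.
  let J : Type w := Σ l m : L, (C.unop.obj.obj l).unop.obj.obj m
  let K : Type w := (Σ (l m m' : L) (_ : m ⟶ m'), (C.unop.obj.obj l).unop.obj.obj m) ⊕
    (Σ (l l' m : L) (_ : l ⟶ l'), (C.unop.obj.obj l').unop.obj.obj m)
  let y (j : J) : L := j.2.1
  let Z (j : J) : D := A.obj j.1
  let y' : K → L := Sum.elim (fun k => k.2.2.1) (fun k => k.2.2.1)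
  let Z' : K → D := Sum.elim (fun k => A.obj k.1) (fun k => A.obj k.1)
  let a (G : L ⥤ D) (t : ∀ j, Z j ⟶ G.obj (y j)) : ∀ k, Z' k ⟶ G.obj (y' k)
    | .inl ⟨l, m, _, g, c⟩ => t ⟨l, m, c⟩ ≫ G.map g
    | .inr ⟨_, l', m, f, c⟩ => A.map f ≫ t ⟨l', m, c⟩
  let b (G : L ⥤ D) (t : ∀ j, Z j ⟶ G.obj (y j)) : ∀ k, Z' k ⟶ G.obj (y' k)
    | .inl ⟨l, _, m', g, c⟩ => t ⟨l, m', (C.unop.obj.obj l).unop.obj.map g c⟩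
    | .inr ⟨l, _, m, f, c⟩ => t ⟨l, m, (C.unop.obj.map f).unop.hom.app m c⟩
  obtain ⟨F, ι, hι, hF⟩ := exists_presented y Z y' Z' a b
    (fun φ t k => by
      rcases k with ⟨l, m, m', g, c⟩ | ⟨l, l', m, f, c⟩
      · exact (Category.assoc _ _ _).trans ((congrArg _ (φ.naturality _).symm).trans
          (Category.assoc _ _ _).symm)
      · exact (Category.assoc _ _ _).symm)
    (fun φ t k => by
      rcases k with ⟨l, m, m', g, c⟩ | ⟨l, l', m, f, c⟩ <;> rfl)
  refine ⟨F, { app := fun l m c => ι ⟨l, m, c⟩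
               naturality_right := fun l m m' g c => hι (.inl ⟨l, m, m', g, c⟩)
               naturality_left := fun {l l'} f m c => hι (.inr ⟨l, l', m, f, c⟩) },
    fun G s => ?_⟩
  obtain ⟨φ, h, h'⟩ := hF G (fun j => s.app j.1 j.2.1 j.2.2) (by
    rintro (⟨l, m, m', g, c⟩ | ⟨l, l', m, f, c⟩)
    · exact s.naturality_right l g c
    · exact s.naturality_left f m c)
  refine ⟨φ, ?_, fun φ' h'' => h' φ' fun j => ?_⟩
  · ext l m c
    exact h ⟨l, m, c⟩
  · exact congrFun (congrFun (congrFun (congrArg ElementwiseHom.app h'') j.1) j.2.1) j.2.2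

variable [HasFiniteProducts L] [HasFiniteProducts D]

variable (L D) in
/-- The bifunctor `(C, A') ↦ Hom(C, Hom(-, A'))`. -/
def covBifunctor : (CoAlg L)ᵒᵖ ⥤ Models L D ⥤ (Dᵒᵖ ⥤ Variety L) :=
  cov ⋙ Functor.whiskeringRight Dᵒᵖ (Variety L) (Variety L) ⋙
    (Functor.whiskeringLeft _ _ _).obj homAlg

/-- The functor corepresenting elementwise families need not preserve products, but its reflection
has the same morphisms into models. -/
theorem exists_circ_obj (hcomm : FiniteProductsCommuteWithFilteredColimits D) (C : CoAlg L)
    (A : Models L D) :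
    ∃ (X : Models L D)
      (e : ∀ A', (X ⟶ A') ≃ (homAlg.obj A ⟶ ((covBifunctor L D).obj (op C)).obj A')),
      ∀ (A' B' : Models L D) (g : X ⟶ A') (f : A' ⟶ B'),
        e B' (g ≫ f) = e A' g ≫ ((covBifunctor L D).obj (op C)).map f := by
  obtain ⟨F, t, ht⟩ := exists_universal_elementwiseHom C A.obj
  obtain ⟨R, hR, η, hη⟩ := exists_reflection hcomm F
  let X : Models L D := ⟨R, hR⟩
  have hb (A' : Models L D) :
      Function.Bijective fun g : X ⟶ A' => t.comp (η ≫ g.hom) := by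
    have := A'.property
    refine ⟨fun g g' h => ?_, fun s => ?_⟩
    · ext1
      exact (hη A'.obj (η ≫ g.hom)).unique rfl ((ht A'.obj _).unique rfl h)
    · obtain ⟨φ, hφ, -⟩ := ht A'.obj s
      obtain ⟨φ', hφ', -⟩ := hη A'.obj φ
      exact ⟨ObjectProperty.homMk φ', (congrArg t.comp hφ').trans hφ⟩
  refine ⟨X, fun A' => (Equiv.ofBijective _ (hb A')).trans (elementwiseHomEquiv C A A'),
    fun A' B' g f => ?_⟩
  refine Eq.trans ?_ (elementwiseHomEquiv_comp C (t.comp (η ≫ g.hom)) f)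
  refine congrArg (elementwiseHomEquiv C A B') ?_
  ext l m c
  simp [Equiv.ofBijective]

/-- A relative adjunction for the bifunctor `(C, A') ↦ Hom(C, Hom(-, A'))` is the same as a
`HomAdjunction`. -/
def homAdjunctionOfRelative {circ : CoAlg L ⥤ Models L D ⥤ Models L D}
    (Φ : RelativeAdjunction homAlg (covBifunctor L D) circ) : HomAdjunction circ where
  homEquiv := Φ.homEquiv
  naturality_one := Φ.naturality_one
  naturality_two := Φ.naturality_two
  naturality_three := Φ.naturality_three

/-- A `HomAdjunction` as a relative adjunction. -/
def relativeOfHomAdjunction {circ : CoAlg L ⥤ Models L D ⥤ Models L D}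
    (Φ : HomAdjunction circ) : RelativeAdjunction homAlg (covBifunctor L D) circ where
  homEquiv := Φ.homEquiv
  naturality_one := Φ.naturality_one
  naturality_two := Φ.naturality_two
  naturality_three := Φ.naturality_three

end

end Circ

/-! ### Existence of `⊙` from small limits. -/

section Pairing

variable {L : Type w} [SmallCategory L] {D : Type u} [Category.{w} D]

/-- The functor `X ↦ Hom_V(B, Hom_D(X, A))` is represented by the weighted limit of `A` with
weight `B`. -/
theorem isRepresentable_hom_homAlg [HasLimitsOfSize.{w, w} D] (B : Variety L) (A : Models L D) :
    (homAlg.obj A ⋙ coyoneda.obj (op B)).IsRepresentable := by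
  -- A morphism of algebras `B ⟶ Hom(X, A)` is exactly a cone over `K` with apex `X`.
  let K : B.obj.Elements ⥤ D := CategoryOfElements.π B.obj ⋙ A.obj
  let v (X : D) (f : X ⟶ limit K) : B ⟶ homAlgObj A (op X) :=
    homAlgMk (fun m b => f ≫ limit.π K (B.obj.elementsMk m b)) fun {m m'} g b =>
      (Category.assoc _ _ _).trans (congrArg (f ≫ ·)
        (limit.w K (CategoryOfElements.homMk (B.obj.elementsMk m b)
          (B.obj.elementsMk m' (B.obj.map g b)) g rfl)))
  let c (X : D) (k : B ⟶ homAlgObj A (op X)) : Cone K :=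
    { pt := X
      π :=
        { app := fun p => homAlgEval k p.1 p.2
          naturality := fun p q g => by
            rw [show homAlgEval k q.1 q.2 = homAlgEval k q.1 (B.obj.map g.val p.2) by rw [g.property]]
            exact (Category.id_comp _).trans (homAlgEval_naturality k g.val p.2).symm } }
  have R : (homAlg.obj A ⋙ coyoneda.obj (op B)).RepresentableBy (limit K) :=
    { homEquiv := fun {X} =>
        { toFun := v X
          invFun := fun k => limit.lift K (c X k)
          left_inv := fun f => limit.hom_ext fun p => limit.lift_π _ _
          right_inv := fun k => homAlgEval_ext fun m b => limit.lift_π (c X k) (B.obj.elementsMk m b) }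
      homEquiv_comp := fun {X X'} f g => homAlgEval_ext (X := op X) fun m b =>
        Category.assoc (obj := D) f g (limit.π K (B.obj.elementsMk m b)) }
  exact R.isRepresentable

/-- A functor `Dᵒᵖ ⥤ V` is of the form `Hom(-, A)` if its underlying functors to `Type` are
representable. -/
theorem exists_homAlg_iso (Θ : Dᵒᵖ ⥤ Variety L)
    (hΘ : ∀ l, ((Θ ⋙ ObjectProperty.ι _).flip.obj l).IsRepresentable) :
    ∃ A : Models L D, Nonempty (homAlg.obj A ≅ Θ) := by
  let Ψ : L ⥤ Dᵒᵖ ⥤ Type w := (Θ ⋙ ObjectProperty.ι _).flip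
  let e (l : L) : yoneda.obj (Ψ.obj l).reprX ≅ Ψ.obj l := (Ψ.obj l).reprW
  let F : L ⥤ D :=
    { obj := fun l => (Ψ.obj l).reprX
      map := fun {l m} f => Yoneda.fullyFaithful.preimage ((e l).hom ≫ Ψ.map f ≫ (e m).inv)
      map_id := fun l => Yoneda.fullyFaithful.map_injective (by simp)
      map_comp := fun f g => Yoneda.fullyFaithful.map_injective (by simp) }
  have hF {l m : L} (f : l ⟶ m) : yoneda.map (F.map f) = (e l).hom ≫ Ψ.map f ≫ (e m).inv :=
    Yoneda.fullyFaithful.map_preimage _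
  let i : F ⋙ yoneda ≅ Ψ := NatIso.ofComponents e fun {l m} f => by
    change yoneda.map (F.map f) ≫ (e m).hom = _
    simp [hF]
  -- Limits of presheaves are pointwise, and at `X` the functor `Ψ` is the algebra `Θ X`. Since
  -- `yoneda` reflects limits, `F` preserves finite products.
  have hΨ : PreservesFiniteProducts Ψ := ⟨fun n => preservesLimitsOfShape_of_evaluation _ _
    fun X => by
      have := (Θ.obj X).property
      exact inferInstanceAs (PreservesLimitsOfShape (Discrete (Fin n)) (Θ.obj X).obj)⟩
  have : PreservesFiniteProducts (F ⋙ yoneda) :=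
    ⟨fun n => preservesLimitsOfShape_of_natIso i.symm⟩
  refine ⟨⟨F, preservesFiniteProducts_of_reflects_of_preserves F yoneda⟩,
    ⟨NatIso.ofComponents (fun X => ObjectProperty.isoMk _
      (NatIso.ofComponents (fun l => (e l).app X) fun {l m} f => ?_)) fun {X Y} g => ?_⟩⟩
  · exact NatTrans.congr_app (i.hom.naturality f) X
  · ext l x
    exact ConcreteCategory.congr_hom ((e l).hom.naturality g) x

/-- The component of `Hom(C, Hom(-, A))` at `l` is `Hom(C l, Hom(-, A))`, which is representable
because `C l` is an algebra. -/
theorem nonempty_covPairing [HasLimitsOfSize.{w, w} D] : Nonempty (CovPairing L D) := by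
  obtain ⟨F, i, h₁, h₂⟩ := exists_bifunctor homAlg (covBifunctor L D) homAlgFullyFaithful
    fun C A => exists_homAlg_iso ((covBifunctor L D).obj (op C) |>.obj A) fun l =>
      isRepresentable_hom_homAlg (C.unop.obj.obj l).unop A
  exact ⟨⟨F, i, h₁, h₂⟩⟩

end Pairing

/-! ### The adjunction between `⊛` and `⊙`. -/

section Adjunction

variable {L : Type w} [SmallCategory L] {D : Type u} [Category.{w} D]
  {circ : CoAlg L ⥤ Models L D ⥤ Models L D}

/-- The bijections `Hom(C ⊛ A, A') ≅ Hom(A, C ⊙ A')` in the presence of a pairing `⊙`. -/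
def HomAdjunction.pairingEquiv (Φ : HomAdjunction circ) (P : CovPairing L D) (C : CoAlg L)
    (A A' : Models L D) :
    ((circ.obj C).obj A ⟶ A') ≃ (A ⟶ (P.functor.obj (op C)).obj A') :=
  (Φ.homEquiv C A A').trans
    ((Iso.homCongr (Iso.refl _) (P.iso C A').symm).trans homAlgFullyFaithful.homEquiv.symm)

/-- Together with `CovPairing.hom_ext`, this reduces the naturality of `pairingEquiv` to that of `Φ`
and `P.iso`. -/
theorem HomAdjunction.map_pairingEquiv (Φ : HomAdjunction circ) (P : CovPairing L D)
    {C : CoAlg L} {A A' : Models L D} (f : (circ.obj C).obj A ⟶ A') :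
    homAlg.map (Φ.pairingEquiv P C A A' f) ≫ (P.iso C A').hom = Φ.homEquiv C A A' f := by
  have h : homAlg.map (Φ.pairingEquiv P C A A' f) = Φ.homEquiv C A A' f ≫ (P.iso C A').inv :=
    
    (homAlgFullyFaithful.map_preimage _).trans (by simp)
  rw [h, Category.assoc, Iso.inv_hom_id, Category.comp_id]

theorem CovPairing.hom_ext (P : CovPairing L D) {C : CoAlg L} {A A' : Models L D}
    {f g : A ⟶ (P.functor.obj (op C)).obj A'}
    (h : homAlg.map f ≫ (P.iso C A').hom = homAlg.map g ≫ (P.iso C A').hom) : f = g :=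
  homAlgFullyFaithful.map_injective ((cancel_mono _).1 h)

/-- The parametrized adjunction of `⊛` and `⊙`. -/
def HomAdjunction.parametrizedAdjunction (Φ : HomAdjunction circ) (P : CovPairing L D) :
    circ ⊣₂ P.functor :=
  ParametrizedAdjunction.mk'
    (fun C => Adjunction.mkOfHomEquiv
      { homEquiv := fun A A' => Φ.pairingEquiv P C A A'
        homEquiv_naturality_left_symm := fun {A B A'} f g => by
          rw [Equiv.symm_apply_eq]
          refine P.hom_ext ?_
          rw [Φ.map_pairingEquiv, Φ.naturality_two, ← Φ.map_pairingEquiv P,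
            Equiv.apply_symm_apply, Functor.map_comp, Category.assoc]
        homEquiv_naturality_right := fun {A A' B'} g f => P.hom_ext (by
          rw [Φ.map_pairingEquiv, Φ.naturality_three, ← Φ.map_pairingEquiv P,
            Functor.map_comp, Category.assoc, Category.assoc, P.iso_naturality_right]) })
    fun {C C'} f A A' g => by
      simp only [Adjunction.mkOfHomEquiv_homEquiv]
      refine P.hom_ext ?_
      rw [Φ.map_pairingEquiv, Φ.naturality_one, ← Φ.map_pairingEquiv P,
        Functor.map_comp, Category.assoc, Category.assoc, P.iso_naturality_left]

theorem HomAdjunction.parametrizedAdjunction_homEquiv (Φ : HomAdjunction circ)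
    (P : CovPairing L D) (C : CoAlg L) (A A' : Models L D) :
    (Φ.parametrizedAdjunction P).homEquiv = Φ.pairingEquiv P C A A' := by
  ext1 f
  simp [ParametrizedAdjunction.homEquiv_eq, HomAdjunction.parametrizedAdjunction]

end Adjunction

/-! ### Actions and co-actions of a Tall–Wraith monoid. -/

namespace CovPairing

variable {L : Type w} [SmallCategory L] {D : Type u} [Category.{w} D]
  (P : CovPairing L D) (T : TallWraithMonoid L)

/-- Through `homAlg` and `P.iso` the pairing becomes composition of functors, and the claim becomes
naturality of `T.sqIso`. -/
theorem assocIso_naturality {A B : Models L D} (f : A ⟶ B) :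
    (P.functor.obj (op T.sq)).map f ≫ (P.assocIso T B).hom =
      (P.assocIso T A).hom ≫
        (P.functor.obj (op T.obj)).map ((P.functor.obj (op T.obj)).map f) := by
  refine P.hom_ext ?_
  have h (A : Models L D) : homAlg.map (P.assocIso T A).hom ≫ (P.iso T.obj _).hom =
      (P.iso T.sq A).hom ≫ Functor.whiskerLeft (homAlg.obj A) T.sqIso.hom ≫
        (Functor.associator _ _ _).inv ≫
          Functor.whiskerRight (P.iso T.obj A).inv (cov.obj (op T.obj)) := by
    have h' : homAlg.map (P.assocIso T A).hom = _ := homAlgFullyFaithful.map_preimage _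
    rw [h']
    simp
  have h₂ : Functor.whiskerRight (P.iso T.obj A).inv (cov.obj (op T.obj)) ≫
      Functor.whiskerRight (homAlg.map ((P.functor.obj (op T.obj)).map f)) (cov.obj (op T.obj)) =
      Functor.whiskerRight (Functor.whiskerRight (homAlg.map f) (cov.obj (op T.obj)))
        (cov.obj (op T.obj)) ≫
      Functor.whiskerRight (P.iso T.obj B).inv (cov.obj (op T.obj)) := by
    have h₃ : (P.iso T.obj A).inv ≫ homAlg.map ((P.functor.obj (op T.obj)).map f) =
        Functor.whiskerRight (homAlg.map f) (cov.obj (op T.obj)) ≫ (P.iso T.obj B).inv := by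
      rw [Iso.inv_comp_eq, ← Category.assoc, Iso.eq_comp_inv, P.iso_naturality_right]
    rw [← Functor.whiskerRight_comp, ← Functor.whiskerRight_comp, h₃]
  rw [Functor.map_comp, Functor.map_comp, Category.assoc, Category.assoc,
    P.iso_naturality_right, reassoc_of% (h A), h, h₂, ← Category.assoc,
    P.iso_naturality_right, Category.assoc]
  congr 1
  ext X : 2
  simp

theorem unitIso_naturality {A B : Models L D} (f : A ⟶ B) :
    (P.functor.obj (op T.unit)).map f ≫ (P.unitIso T B).hom = (P.unitIso T A).hom ≫ f := by
  refine homAlgFullyFaithful.map_injective ?_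
  have h (A : Models L D) : homAlg.map (P.unitIso T A).hom =
      (P.iso T.unit A).hom ≫ Functor.whiskerLeft (homAlg.obj A) T.unitIso.hom ≫
        (Functor.rightUnitor _).hom := by
    have h' : homAlg.map (P.unitIso T A).hom = _ := homAlgFullyFaithful.map_preimage _
    rw [h']
    simp
  rw [Functor.map_comp, Functor.map_comp, h, h, ← Category.assoc,
    P.iso_naturality_right, Category.assoc, Category.assoc]
  congr 1
  ext X : 2
  simp

variable {P} {circ : CoAlg L ⥤ Models L D ⥤ Models L D} (adj : circ ⊣₂ P.functor)

/-- Transposing twice turns precomposition with `circAssoc` into composition with an isomorphism;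
invertibility and the comparison of associativity laws both rest on this. -/
theorem homEquiv_circAssoc_comp {A B : Models L D}
    (g : (circ.obj T.obj).obj ((circ.obj T.obj).obj A) ⟶ B) :
    adj.homEquiv (circAssoc T adj A ≫ g) =
      adj.homEquiv (adj.homEquiv g) ≫ (P.assocIso T B).inv := by
  have h : (P.assocIso T _).inv ≫ (P.functor.obj (op T.sq)).map g =
      (P.functor.obj (op T.obj)).map ((P.functor.obj (op T.obj)).map g) ≫
        (P.assocIso T B).inv := by
    rw [Iso.inv_comp_eq, ← Category.assoc, Iso.eq_comp_inv, assocIso_naturality]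
  have h' : adj.homEquiv (adj.homEquiv g) = adj.homEquiv (𝟙 ((circ.obj T.obj).obj A)) ≫
      (P.functor.obj (op T.obj)).map (adj.homEquiv (𝟙 _) ≫
        (P.functor.obj (op T.obj)).map g) := by
    rw [← adj.homEquiv_naturality_three, ← adj.homEquiv_naturality_three, Category.id_comp,
      Category.id_comp]
  rw [adj.homEquiv_naturality_three, circAssoc, Equiv.apply_symm_apply, h', Category.assoc,
    Category.assoc, h, Functor.map_comp, Category.assoc, Category.assoc]

theorem homEquiv_circUnit_comp {A B : Models L D} (g : A ⟶ B) :
    adj.homEquiv (circUnit T adj A ≫ g) = g ≫ (P.unitIso T B).inv := by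
  rw [adj.homEquiv_naturality_three, circUnit, Equiv.apply_symm_apply, Iso.inv_comp_eq,
    ← Category.assoc, Iso.eq_comp_inv, unitIso_naturality]

/-- By Yoneda it suffices that precomposition is bijective; after transposition it is a composite of
bijections. -/
theorem isIso_circAssoc (A : Models L D) : IsIso (circAssoc T adj A) := by
  rw [isIso_iff_coyoneda_map_bijective]
  intro B
  refine (adj.homEquiv.bijective.of_comp_iff' _).1 ?_
  have h : (⇑adj.homEquiv ∘ fun g => circAssoc T adj A ≫ g) = fun g =>
      ((P.assocIso T B).symm.homToEquiv (adj.homEquiv (adj.homEquiv g))) :=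
    funext fun g => homEquiv_circAssoc_comp T adj g
  rw [h]
  exact ((adj.homEquiv.trans adj.homEquiv).trans (P.assocIso T B).symm.homToEquiv).bijective

theorem isIso_circUnit (A : Models L D) : IsIso (circUnit T adj A) := by
  rw [isIso_iff_coyoneda_map_bijective]
  intro B
  refine (adj.homEquiv.bijective.of_comp_iff' _).1 ?_
  have h : (⇑adj.homEquiv ∘ fun g => circUnit T adj A ≫ g) = fun g =>
      (P.unitIso T B).symm.homToEquiv g :=
    funext fun g => homEquiv_circUnit_comp T adj g
  rw [h]
  exact (P.unitIso T B).symm.homToEquiv.bijective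

/-- The axioms correspond one by one. With `a` the transpose of `ρ`, the morphism `T ⊛ a` followed
by `a` transposes to `a ≫ ρ` and then to `ρ` followed by `T ⊙ ρ`, while precomposing `a` with the
map induced by `T.mul` transposes to `ρ` followed by the map it induces on `⊙`. -/
theorem isCoaction_iff_isAction {A : Models L D} (ρ : A ⟶ (P.functor.obj (op T.obj)).obj A) :
    P.IsCoaction T ρ ↔ IsAction T adj (adj.homEquiv.symm ρ) := by
  have h₁ : (ρ ≫ (P.functor.map T.mul.op).app A ≫ (P.assocIso T A).hom =
      ρ ≫ (P.functor.obj (op T.obj)).map ρ) ↔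
      circAssoc T adj A ≫ (circ.obj T.obj).map (adj.homEquiv.symm ρ) ≫ adj.homEquiv.symm ρ =
        (circ.map T.mul).app A ≫ adj.homEquiv.symm ρ := by
    rw [← adj.homEquiv.apply_eq_iff_eq, homEquiv_circAssoc_comp, adj.homEquiv_naturality_two,
      adj.homEquiv_naturality_one, adj.homEquiv_naturality_three, Equiv.apply_symm_apply,
      Iso.comp_inv_eq, Category.assoc, eq_comm]
  have h₂ : (ρ ≫ (P.functor.map T.one.op).app A ≫ (P.unitIso T A).hom = 𝟙 A) ↔
      (circ.map T.one).app A ≫ adj.homEquiv.symm ρ = circUnit T adj A := by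
    rw [← adj.homEquiv.apply_eq_iff_eq, adj.homEquiv_naturality_one, Equiv.apply_symm_apply,
      circUnit, Equiv.apply_symm_apply, ← Category.assoc, ← Iso.eq_comp_inv, Category.id_comp]
  exact ⟨fun h => ⟨h₁.1 h.coassoc, h₂.1 h.counit⟩, fun h => ⟨h₁.2 h.assoc, h₂.2 h.unit⟩⟩

end CovPairing

end VarietyOfAlgebras

open VarietyOfAlgebras
theorem mainTheorem5 {L : Type w} [SmallCategory L] [HasFiniteProducts L]
    (hL : IsLawvereTheory L) {D : Type u} [Category.{w} D]
    [HasFiniteProducts D] [HasColimitsOfSize.{w, w} D]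
    (E M : MorphismProperty D) (hEM : IsFactorizationCategory E M)
    (hE : E.IsStableUnderFiniteProducts) (hcwp : IsCoWellPowered E)
    (hcomm : FiniteProductsCommuteWithFilteredColimits D) :
    (HasLimitsOfSize.{w, w} D → Nonempty (CovPairing L D)) ∧
    ∃ (circ : CoAlg L ⥤ Models L D ⥤ Models L D) (Φ : HomAdjunction circ),
      (∀ circ' : CoAlg L ⥤ Models L D ⥤ Models L D,
        Nonempty (HomAdjunction circ') → Nonempty (circ' ≅ circ)) ∧
      ∀ P : CovPairing L D, ∃ adj : circ ⊣₂ P.functor,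
        (∀ (C : CoAlg L) (A A' : Models L D) (f : (circ.obj C).obj A ⟶ A'),
          homAlg.map (adj.homEquiv f) ≫ (P.iso C A').hom = Φ.homEquiv C A A' f) ∧
        ∀ (T : TallWraithMonoid L) (A : Models L D),
          IsIso (CovPairing.circAssoc T adj A) ∧ IsIso (CovPairing.circUnit T adj A) ∧
          ∀ ρ : A ⟶ (P.functor.obj (op T.obj)).obj A,
            P.IsCoaction T ρ ↔ CovPairing.IsAction T adj (adj.homEquiv.symm ρ) := by
  refine ⟨fun _ => nonempty_covPairing, ?_⟩
  obtain ⟨circ, ⟨Φ⟩⟩ := exists_relativeAdjunction homAlg (covBifunctor L D)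
    (exists_circ_obj hcomm)
  refine ⟨circ, homAdjunctionOfRelative Φ, fun circ' ⟨Φ'⟩ =>
    Φ.nonempty_iso (relativeOfHomAdjunction Φ'), fun P =>
    ⟨(homAdjunctionOfRelative Φ).parametrizedAdjunction P, fun C A A' f => ?_, fun T A =>
      ⟨CovPairing.isIso_circAssoc T _ A, CovPairing.isIso_circUnit T _ A,
        CovPairing.isCoaction_iff_isAction T _⟩⟩⟩
  rw [HomAdjunction.parametrizedAdjunction_homEquiv, HomAdjunction.map_pairingEquiv]
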